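/- Let $d$ be a nonnegative integer and let $A,P\in\mathrm{GL}(d,\mathbb R)$ be arbitrary. Let $G=\mathbb R^d\rtimes\langle A\rangle$, $\langle A\rangle=\{A^j:j\in\mathbb Z\}$, with group law $(x,h)(y,k)=(x+hy,hk)$, the product of the Euclidean topology on $\mathbb R^d$ and the discrete topology on $\langle A\rangle$, and left Haar measure $d\mu_G(x,h)=|\det h|^{-1}\,dx\,d\mu_c(h)$, where $\mu_c$ is counting measure on $\langle A\rangle$. Let $\pi$ be the unitary representation of $G$ on $L^2(\mathbb R^d)$ given by $$\pi(x,h)f(t)=|\det h|^{-1/2}f\big(h^{-1}(t-x)\big),$$ and let $C_\psi f(g)=\langle f,\pi(g)\psi\rangle$ for $f,\psi\in L^2(\mathbb R^d)$, $g\in G$. Let $W(L^2)$ be the space of all $F\in L^\infty_{\mathrm{loc}}(G)$ such that $g\mapsto\sup_{q\in Q}|F(gq)|$ is in $L^2(G,\mu_G)$ for some compact neighbourhood $Q$ of the identity of $G$ (equivalently, for every such $Q$), and let $\mathcal B_\pi$ be the set of all $\psi\in L^2(\mathbb R^d)$ with $C_\psi f\in W(L^2)$ for every $f\in L^2(\mathbb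 R^d)$. Write $\widehat\psi$ for the Fourier transform on $L^2(\mathbb R^d)$ normalized by $\widehat\psi(\xi)=\int\psi(x)e^{-2\pi i x\cdot\xi}\,dx$ for integrable $\psi$. Let $\psi\in\mathcal B_\pi$, and consider the discrete wavelet system, a family indexed by $(j,k)\in\mathbb Z\times\mathbb Z^d$, $$\pi(A^jPk,A^j)\psi=|\det A|^{-j/2}\,\psi(A^{-j}\cdot{}-Pk).$$ (1) If this system is a frame for $L^2(\mathbb R^d)$ with bounds $0<C_1\le C_2<\infty$, i.e. $$C_1\|f\|^2\le\sum_{j\in\mathbb Z}\sum_{k\in\mathbb Z^d}|\langle f,\pi(A^jPk,A^j)\psi\rangle|^2\le C_2\|f\|^2\quad\text{for all }f\in L^2(\mathbb R^d),$$ then the semi-continuous system $\{\pi(g)\psi\}_{g\in G}=\{\pi(x,A^j)\psi\}_{x\in\mathbb R^d,\,j\in\mathbb Z}$ is a continuous frame for $L^2(\mathbb R^d)$ with bounds $C_1|\det P|$ and $C_2|\det P|$, i.e. for all $f\in L^2(\mathbb R^d)$ the function $C_\psi f$ is $\mu_G$-measurable and $$C_1|\det P|\,\|f\|^2\le\int_G|\langle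 f,\pi(g)\psi\rangle|^2\,d\mu_G(g)\le C_2|\det P|\,\|f\|^2,$$ and moreover $$C_1|\det P|\le\sum_{j\in\mathbb Z}|\widehat\psi((A^t)^j\xi)|^2\le C_2|\det P|\quad\text{for a.e. }\xi\in\mathbb R^d.$$ (2) In particular, if the discrete wavelet system is a Parseval frame (i.e. $C_1=C_2=1$), then $\{\pi(x,A^j)\psi\}_{x\in\mathbb R^d,\,j\in\mathbb Z}$ is a tight continuous frame with bound $|\det P|$, and $$\sum_{j\in\mathbb Z}|\widehat\psi((A^t)^j\xi)|^2=|\det P|\quad\text{for a.e. }\xi\in\mathbb R^d.$$ -/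

import Mathlib

open MeasureTheory FourierTransform Topology
open scoped ENNReal MatrixGroups

namespace WaveletFrames

noncomputable section

/-- The Euclidean space `ℝ^d`. -/
abbrev Space (d : ℕ) : Type := EuclideanSpace ℝ (Fin d)

/-- The complex Hilbert space `L²(ℝ^d)` with respect to Lebesgue measure. -/
abbrev L2Space (d : ℕ) : Type := Lp (α := Space d) ℂ 2 volume

/-- The matrix-vector product `M x`. -/
def act {d : ℕ} (M : Matrix (Fin d) (Fin d) ℝ) (x : Space d) : Space d :=
  Matrix.toEuclideanLin M x

theorem act_one {d : ℕ} (x : Space d) : act 1 x = x := by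
  simp [act]

theorem act_mul {d : ℕ} (M N : Matrix (Fin d) (Fin d) ℝ) (x : Space d) :
    act (M * N) x = act M (act N x) := by
  simp [act, Matrix.toLpLin_apply, Matrix.mulVec_mulVec]

theorem act_add {d : ℕ} (M : Matrix (Fin d) (Fin d) ℝ) (x y : Space d) :
    act M (x + y) = act M x + act M y := by
  simp [act]

/-! ## The group `G = ℝ^d ⋊ ⟨A⟩` -/

/-- The semidirect product `ℝ^d ⋊ ⟨A⟩`: pairs `(x, h)` with `x ∈ ℝ^d` and `h` in the cyclic group
`⟨A⟩ = {A^j : j ∈ ℤ}`. -/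
@[ext]
structure AffGroup {d : ℕ} (A : GL (Fin d) ℝ) : Type where
  /-- the translation part -/
  trans : Space d
  /-- the dilation part -/
  dil : Subgroup.zpowers A

namespace AffGroup

variable {d : ℕ} {A : GL (Fin d) ℝ}

/-- The dilation part as a matrix. -/
def mat (g : AffGroup A) : Matrix (Fin d) (Fin d) ℝ := ((g.dil : GL (Fin d) ℝ) : Matrix _ _ ℝ)

/-- The inverse of the dilation part as a matrix. -/
def matInv (g : AffGroup A) : Matrix (Fin d) (Fin d) ℝ :=
  ((g.dil⁻¹ : Subgroup.zpowers A) : GL (Fin d) ℝ).val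

/-- The group law `(x, h) (y, k) = (x + h y, h k)`. -/
instance : Mul (AffGroup A) := ⟨fun g g' => ⟨g.trans + act g.mat g'.trans, g.dil * g'.dil⟩⟩

instance : One (AffGroup A) := ⟨⟨0, 1⟩⟩

instance : Inv (AffGroup A) := ⟨fun g => ⟨-act g.matInv g.trans, g.dil⁻¹⟩⟩

theorem mul_def (g g' : AffGroup A) :
    g * g' = ⟨g.trans + act g.mat g'.trans, g.dil * g'.dil⟩ := rfl

theorem one_def : (1 : AffGroup A) = ⟨0, 1⟩ := rfl

theorem inv_def (g : AffGroup A) : g⁻¹ = ⟨-act g.matInv g.trans, g.dil⁻¹⟩ := rfl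

instance : Group (AffGroup A) :=
  Group.ofLeftAxioms
    (fun a b c => by
      ext1
      · simp [mul_def, mat, act_mul, act_add, add_assoc]
      · simp [mul_def, mul_assoc])
    (fun a => by
      ext1
      · simp [mul_def, one_def, mat, act_one]
      · simp [mul_def, one_def])
    (fun a => by
      ext1
      · simp [mul_def, inv_def, one_def, mat, matInv]
      · simp [mul_def, inv_def, one_def])

/-- The topology of `G` is the product of the Euclidean topology on `ℝ^d` and the discrete topology
on `⟨A⟩`. -/
instance : TopologicalSpace (AffGroup A) :=
  TopologicalSpace.induced trans inferInstance ⊓ TopologicalSpace.induced dil ⊥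

instance : MeasurableSpace (AffGroup A) := borel _

instance : BorelSpace (AffGroup A) := ⟨rfl⟩

/-- The left Haar measure `dμ_G(x, h) = |det h|⁻¹ dx dμ_c(h)`, with `dx` Lebesgue measure on `ℝ^d`
and `μ_c` counting measure on `⟨A⟩`. -/
def haar (A : GL (Fin d) ℝ) : Measure (AffGroup A) :=
  Measure.sum fun h : Subgroup.zpowers A =>
    ENNReal.ofReal (|((h : GL (Fin d) ℝ) : Matrix (Fin d) (Fin d) ℝ).det|⁻¹) •
      (volume : Measure (Space d)).map (fun x => (⟨x, h⟩ : AffGroup A))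

end AffGroup

/-! ## The quasi-regular representation -/

theorem map_act {d : ℕ} (M : GL (Fin d) ℝ) (x : Space d) :
    ∃ c : ℝ≥0∞, c ≠ ∞ ∧
      (volume : Measure (Space d)).map (fun t => act (M : Matrix _ _ ℝ) (t - x)) = c • volume := by
  have hdet : LinearMap.det (Matrix.toEuclideanLin (M : Matrix (Fin d) (Fin d) ℝ)) ≠ 0 := by
    have h : LinearMap.det (Matrix.toEuclideanLin (M : Matrix (Fin d) (Fin d) ℝ))
        = (M : Matrix (Fin d) (Fin d) ℝ).det := by
      rw [Matrix.toEuclideanLin, Matrix.toLpLin_eq_toLin, LinearMap.det_toLin]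
    rw [h]
    exact M.isUnit.map Matrix.detMonoidHom |>.ne_zero
  refine ⟨ENNReal.ofReal |(LinearMap.det (Matrix.toEuclideanLin
    (M : Matrix (Fin d) (Fin d) ℝ)))⁻¹|, ENNReal.ofReal_ne_top, ?_⟩
  rw [← Measure.map_linearMap_addHaar_eq_smul_addHaar (volume : Measure (Space d)) hdet]
  have hm : Measurable (Matrix.toEuclideanLin (M : Matrix (Fin d) (Fin d) ℝ)) :=
    (LinearMap.continuous_of_finiteDimensional _).measurable
  have hs : (volume : Measure (Space d)).map (fun t => t - x) = volume :=
    (measurePreserving_sub_right volume x).map_eq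
  conv_rhs => rw [← hs]
  rw [Measure.map_map hm (by fun_prop)]
  rfl

theorem memLp_dilate {d : ℕ} (M : GL (Fin d) ℝ) (x : Space d) (c : ℂ) (f : L2Space d) :
    MemLp (fun t => c * f (act (M : Matrix _ _ ℝ) (t - x))) 2 (volume : Measure (Space d)) := by
  obtain ⟨k, hk, hmap⟩ := map_act M x
  have hm : Measurable fun t : Space d => act (M : Matrix _ _ ℝ) (t - x) :=
    (LinearMap.continuous_of_finiteDimensional _).measurable.comp (by fun_prop)
  have h : MemLp f 2 ((volume : Measure (Space d)).map
      fun t => act (M : Matrix _ _ ℝ) (t - x)) := by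
    rw [hmap]
    exact (Lp.memLp f).smul_measure hk
  exact (h.comp_of_map hm.aemeasurable).const_mul c

/-- The quasi-regular representation of `G = ℝ^d ⋊ ⟨A⟩` on `L²(ℝ^d)`:
`π(x, h) f (t) = |det h|^{-1/2} f(h⁻¹ (t - x))`. -/
def quasiReg {d : ℕ} {A : GL (Fin d) ℝ} (g : AffGroup A) (f : L2Space d) : L2Space d :=
  (memLp_dilate ((g.dil⁻¹ : Subgroup.zpowers A) : GL (Fin d) ℝ) g.trans
    ((|g.mat.det| ^ (-(1 / 2) : ℝ) : ℝ) : ℂ) f).toLp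
    (fun t => ((|g.mat.det| ^ (-(1 / 2) : ℝ) : ℝ) : ℂ) * f (act g.matInv (t - g.trans)))

/-- The wavelet transform `C_ψ f (g) = ⟨f, π(g) ψ⟩`, with `⟨·, ·⟩` linear in its first argument, whereas
Mathlib's `inner` is linear in its second. -/
def waveletTransform {d : ℕ} (A : GL (Fin d) ℝ) (ψ f : L2Space d) (g : AffGroup A) : ℂ :=
  inner ℂ (quasiReg g ψ) f

/-- The local maximal function `M F (g) = sup_{q ∈ Q} |F (g q)|`. -/
def maximalFunction {G : Type*} [Mul G] (Q : Set G) (F : G → ℂ) (g : G) : ℝ≥0∞ :=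
  ⨆ q ∈ Q, ‖F (g * q)‖ₑ

/-- The space `W(L²)` on `G = ℝ^d ⋊ ⟨A⟩`: all `F ∈ L^∞_loc(G)` with `M F ∈ L²(G)` for a compact unit
neighbourhood `Q`. (The space does not depend on the choice of `Q`.) -/
def wienerL2 {d : ℕ} (A : GL (Fin d) ℝ) : Set (AffGroup A → ℂ) :=
  {F | (∀ K : Set (AffGroup A), IsCompact K → MemLp F ∞ ((AffGroup.haar A).restrict K)) ∧
    ∃ Q : Set (AffGroup A), IsCompact Q ∧ Q ∈ 𝓝 (1 : AffGroup A) ∧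
      ∫⁻ g, maximalFunction Q F g ^ 2 ∂(AffGroup.haar A) < ∞}

/-- The space `𝓑_π` of all `ψ ∈ L²(ℝ^d)` with `C_ψ f ∈ W(L²)` for all `f ∈ L²(ℝ^d)`. -/
def besselSpace {d : ℕ} (A : GL (Fin d) ℝ) : Set (L2Space d) :=
  {ψ | ∀ f : L2Space d, waveletTransform A ψ f ∈ wienerL2 A}

/-! ## Frames -/

/-- The family `(φ i)` is a frame for `H` with frame bounds `0 < C₁ ≤ C₂ < ∞`. -/
def IsFrame {H ι : Type*} [NormedAddCommGroup H] [InnerProductSpace ℂ H]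
    (φ : ι → H) (C₁ C₂ : ℝ) : Prop :=
  0 < C₁ ∧ C₁ ≤ C₂ ∧ ∀ f : H,
    ENNReal.ofReal (C₁ * ‖f‖ ^ 2) ≤ ∑' i, ‖(inner ℂ (φ i) f : ℂ)‖ₑ ^ 2 ∧
    ∑' i, ‖(inner ℂ (φ i) f : ℂ)‖ₑ ^ 2 ≤ ENNReal.ofReal (C₂ * ‖f‖ ^ 2)

/-- The family `(φ x)`, indexed by a measure space `(X, μ)`, is a continuous frame for `H` with frame
bounds `0 < C₁ ≤ C₂ < ∞`. -/
def IsContinuousFrame {H X : Type*} [NormedAddCommGroup H] [InnerProductSpace ℂ H]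
    [MeasurableSpace X] (μ : Measure X) (φ : X → H) (C₁ C₂ : ℝ) : Prop :=
  0 < C₁ ∧ C₁ ≤ C₂ ∧ ∀ f : H,
    AEStronglyMeasurable (fun x => (inner ℂ (φ x) f : ℂ)) μ ∧
    ENNReal.ofReal (C₁ * ‖f‖ ^ 2) ≤ ∫⁻ x, ‖(inner ℂ (φ x) f : ℂ)‖ₑ ^ 2 ∂μ ∧
    ∫⁻ x, ‖(inner ℂ (φ x) f : ℂ)‖ₑ ^ 2 ∂μ ≤ ENNReal.ofReal (C₂ * ‖f‖ ^ 2)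

/-- The point `(A^j P k, A^j)` of `G`, for `j ∈ ℤ` and `k ∈ ℤ^d`. -/
def latticePoint {d : ℕ} (A P : GL (Fin d) ℝ) (i : ℤ × (Fin d → ℤ)) : AffGroup A :=
  ⟨act ((A ^ i.1 : GL (Fin d) ℝ) : Matrix (Fin d) (Fin d) ℝ)
      (act (P : Matrix (Fin d) (Fin d) ℝ) (WithLp.toLp 2 fun n => (i.2 n : ℝ))),
    ⟨A ^ i.1, i.1, rfl⟩⟩

/-- The discrete wavelet system `π(A^j P k, A^j) ψ = |det A|^{-j/2} ψ(A^{-j} · - P k)`, indexed by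
`(j, k) ∈ ℤ × ℤ^d`. -/
def discreteSystem {d : ℕ} (A P : GL (Fin d) ℝ) (ψ : L2Space d) (i : ℤ × (Fin d → ℤ)) :
    L2Space d :=
  quasiReg (latticePoint A P i) ψ

/-- The semi-continuous wavelet system `π(x, A^j) ψ`, the orbit of `ψ` under `G`. -/
def semiContinuousSystem {d : ℕ} (A : GL (Fin d) ℝ) (ψ : L2Space d) (g : AffGroup A) : L2Space d :=
  quasiReg g ψ

/-- The Calderón sum `∑_{j ∈ ℤ} |ψ̂((Aᵗ)^j ξ)|²`, with values in `[0, ∞]`. Here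
`ψ̂(ξ) = ∫ ψ(x) e^{-2πi x·ξ} dx` on integrable `ψ`. -/
def calderonSum {d : ℕ} (A : GL (Fin d) ℝ) (ψ : L2Space d) (ξ : Space d) : ℝ≥0∞ :=
  ∑' j : ℤ, ‖(𝓕 ψ : L2Space d) (act ((A : Matrix (Fin d) (Fin d) ℝ).transpose ^ j) ξ)‖ₑ ^ 2

end

end WaveletFrames

/-! Write `F` for the wavelet transform of `f`. Replacing `f` by its translate by `-x` preserves the
norm and moves the sampling points, so the frame inequality says that for every `x` the sum over `h
∈ ⟨A⟩` and `k ∈ ℤ^d` of `|F(x + hPk, h)|²` lies between `C₁‖f‖²` and `C₂‖f‖²`. For fixed `h` the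
inner sum is the periodization of `|F(·, h)|²` along the lattice `hPℤ^d`, and its mean over a period
is `|det h|⁻¹ |det P|⁻¹ ∫ |F(x, h)|² dx`. Summed over `h`, these means give `|det P|⁻¹ ∫_G |F|²
dμ_G`, which is the first claim.

The lattices `hPℤ^d` need not share a period, so the mean in `x` is taken over balls of growing
radius (`tendsto_average_periodization`). Exchanging this limit with the sum over `h` is where `ψ ∈
𝓑_π` enters: the local maximal function of `F` bounds each periodization uniformly in `x`
(`tsum_sq_le_lintegral_maximalFunction`), and since it is square integrable on `G`, the bounds are
summable over `h`. Dominated convergence applies (`tsum_mean_periodization_mem_Icc`).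

For the Calderón sum, take `f` whose Fourier transform is the indicator of a set `E` of finite
measure. Plancherel in `x` turns the integral over `G` into the integral of the Calderón sum over
`E` (`lintegral_haar_inner_quasiReg_sq`). As `E` is arbitrary, the frame bounds become pointwise
bounds. -/

namespace WaveletFrames

noncomputable section

/-! ### Means of lattice periodizations over large balls. -/

section LatticeAverage

open Metric Filter

variable {ι E : Type*} [Fintype ι] [NormedAddCommGroup E] [NormedSpace ℝ E]

/-- The sum of the values of `g` over the translate by `x` of the lattice spanned by `b`. -/
def periodization (b : Module.Basis ι ℝ E) (g : E → ℝ≥0∞) (x : E) : ℝ≥0∞ :=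
  ∑' k : ι → ℤ, g (x + ∑ i, k i • b i)

theorem tsum_span_int {α : Type*} [AddCommMonoid α] [TopologicalSpace α]
    (b : Module.Basis ι ℝ E) (F : E → α) :
    ∑' l : Submodule.span ℤ (Set.range b), F l = ∑' k : ι → ℤ, F (∑ i, k i • b i) := by
  rw [← (b.restrictScalars ℤ).equivFun.symm.toEquiv.tsum_eq]
  refine tsum_congr fun k => ?_
  simp [Module.Basis.equivFun_symm_apply, Module.Basis.restrictScalars_apply]

variable [MeasurableSpace E] [BorelSpace E]

theorem measurable_periodization (b : Module.Basis ι ℝ E) {g : E → ℝ≥0∞} (hg : Measurable g) :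
    Measurable (periodization b g) :=
  Measurable.tsum fun _ => hg.comp (measurable_id.add_const _)

variable [FiniteDimensional ℝ E] (μ : Measure E) [μ.IsAddHaarMeasure]

/-- Unfolding: the lattice translates of the fundamental domain tile `E`. -/
theorem lintegral_fundamentalDomain_periodization (b : Module.Basis ι ℝ E) {g : E → ℝ≥0∞}
    (hg : Measurable g) (u : E) :
    ∫⁻ v in ZSpan.fundamentalDomain b, periodization b g (u + v) ∂μ = ∫⁻ x, g x ∂μ := by
  have : VAddInvariantMeasure (Submodule.span ℤ (Set.range b)) E μ :=
    ⟨fun l s _ => measure_preimage_add μ (l : E) s⟩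
  have := (ZSpan.isAddFundamentalDomain b μ).lintegral_eq_tsum'' (fun v => g (u + v))
  rw [lintegral_add_left_eq_self g u] at this
  rw [this, ← lintegral_tsum fun l => by
    exact (hg.comp (measurable_const.add (measurable_const_vadd l))).aemeasurable]
  refine lintegral_congr fun v => ?_
  rw [periodization, ← tsum_span_int b (fun l => g (u + v + l))]
  refine tsum_congr fun l => ?_
  rw [Submodule.vadd_def, vadd_eq_add, add_assoc, add_comm v]

/-- Integrate the unfolding identity over `u` in the ball, exchange the integrals, and substitute `w
= u + v`. The radius may be negative, with an empty ball; this is convenient for radii `R - δ`. -/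
theorem measure_ball_mul_lintegral (b : Module.Basis ι ℝ E) {g : E → ℝ≥0∞}
    (hg : Measurable g) (S : ℝ) :
    μ (ball 0 S) * ∫⁻ x, g x ∂μ =
      ∫⁻ v in ZSpan.fundamentalDomain b, ∫⁻ w, (ball 0 S).indicator 1 (w - v) *
        periodization b g w ∂μ ∂μ := by
  have hp := measurable_periodization b hg
  calc μ (ball 0 S) * ∫⁻ x, g x ∂μ
      = ∫⁻ u in ball 0 S, ∫⁻ v in ZSpan.fundamentalDomain b, periodization b g (u + v) ∂μ ∂μ := by
        simp_rw [lintegral_fundamentalDomain_periodization μ b hg]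
        rw [setLIntegral_const, mul_comm]
    _ = ∫⁻ v in ZSpan.fundamentalDomain b, ∫⁻ u in ball 0 S, periodization b g (u + v) ∂μ ∂μ :=
        lintegral_lintegral_swap (hp.comp (measurable_fst.add measurable_snd)).aemeasurable
    _ = _ := by
        refine lintegral_congr fun v => ?_
        rw [← lintegral_indicator measurableSet_ball]
        conv_rhs => rw [← lintegral_add_right_eq_self _ v]
        refine lintegral_congr fun w => ?_
        by_cases h : w ∈ ball (0 : E) S <;> simp_all

/-- A shift by `v` in the fundamental domain moves points by at most `δ`, so `w - v` stays in the
ball of radius `R + δ` when `w` has norm below `R`. -/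
theorem measure_mul_setLIntegral_periodization_le (b : Module.Basis ι ℝ E) {g : E → ℝ≥0∞}
    (hg : Measurable g) {δ : ℝ} (hδ : ∀ v ∈ ZSpan.fundamentalDomain b, ‖v‖ ≤ δ) (R : ℝ) :
    μ (ZSpan.fundamentalDomain b) * ∫⁻ x in ball 0 R, periodization b g x ∂μ ≤
      μ (ball 0 (R + δ)) * ∫⁻ x, g x ∂μ := by
  rw [measure_ball_mul_lintegral μ b hg, mul_comm, ← setLIntegral_const]
  refine setLIntegral_mono' (ZSpan.fundamentalDomain_measurableSet b) fun v hv => ?_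
  rw [← lintegral_indicator measurableSet_ball]
  refine lintegral_mono fun w => ?_
  by_cases h : w ∈ ball (0 : E) R
  · have : w - v ∈ ball (0 : E) (R + δ) := by
      rw [mem_ball_zero_iff] at h ⊢
      linarith [norm_sub_le w v, hδ v hv]
    simp [h, Set.indicator_of_mem this]
  · simp [h]

theorem measure_ball_mul_lintegral_le (b : Module.Basis ι ℝ E) {g : E → ℝ≥0∞}
    (hg : Measurable g) {δ : ℝ} (hδ : ∀ v ∈ ZSpan.fundamentalDomain b, ‖v‖ ≤ δ) (R : ℝ) :
    μ (ball 0 (R - δ)) * ∫⁻ x, g x ∂μ ≤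
      μ (ZSpan.fundamentalDomain b) * ∫⁻ x in ball 0 R, periodization b g x ∂μ := by
  rw [measure_ball_mul_lintegral μ b hg, mul_comm (μ _), ← setLIntegral_const]
  refine setLIntegral_mono' (ZSpan.fundamentalDomain_measurableSet b) fun v hv => ?_
  rw [← lintegral_indicator measurableSet_ball]
  refine lintegral_mono fun w => ?_
  by_cases h : w - v ∈ ball (0 : E) (R - δ)
  · have : w ∈ ball (0 : E) R := by
      rw [mem_ball_zero_iff] at h ⊢
      linarith [norm_le_norm_sub_add w v, hδ v hv]
    simp [Set.indicator_of_mem h, Set.indicator_of_mem this]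
  · simp [Set.indicator_of_notMem h]

theorem tendsto_measure_ball_add_div (c : ℝ) :
    Tendsto (fun R : ℝ => μ (ball 0 (R + c)) / μ (ball 0 R)) atTop (𝓝 1) := by
  have hlim : Tendsto (fun R : ℝ => ENNReal.ofReal ((1 + c * R⁻¹) ^ Module.finrank ℝ E)) atTop
      (𝓝 1) := by
    have : Tendsto (fun R : ℝ => (1 + c * R⁻¹) ^ Module.finrank ℝ E) atTop (𝓝 1) := by
      simpa using ((tendsto_inv_atTop_zero.const_mul c).const_add 1).pow (Module.finrank ℝ E)
    simpa using ENNReal.tendsto_ofReal this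
  refine hlim.congr' ?_
  filter_upwards [eventually_gt_atTop 0, eventually_gt_atTop (-c)] with R hR hRc
  have h0 : μ (ball (0 : E) 1) ≠ 0 := (measure_ball_pos μ _ one_pos).ne'
  have h1 : μ (ball (0 : E) 1) ≠ ∞ := measure_ball_lt_top.ne
  rw [Measure.addHaar_ball_of_pos μ _ hR, Measure.addHaar_ball_of_pos μ _ (by linarith : 0 < R + c),
    ENNReal.mul_div_mul_right _ _ h0 h1, ← ENNReal.ofReal_div_of_pos (by positivity), ← div_pow]
  congr 2
  field_simp

/-- The mean of a periodization over large balls converges to the mean over a period. -/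
theorem tendsto_average_periodization (b : Module.Basis ι ℝ E) {g : E → ℝ≥0∞}
    (hg : Measurable g) :
    Tendsto (fun R : ℝ => (μ (ball 0 R))⁻¹ * ∫⁻ x in ball 0 R, periodization b g x ∂μ) atTop
      (𝓝 ((μ (ZSpan.fundamentalDomain b))⁻¹ * ∫⁻ x, g x ∂μ)) := by
  obtain ⟨δ, hδ⟩ := (ZSpan.fundamentalDomain_isBounded b).exists_norm_le
  have hD0 : μ (ZSpan.fundamentalDomain b) ≠ 0 := ZSpan.measure_fundamentalDomain_ne_zero b
  have hDt : μ (ZSpan.fundamentalDomain b) ≠ ∞ :=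
    (ZSpan.fundamentalDomain_isBounded b).measure_lt_top.ne
  have key (c : ℝ) : Tendsto (fun R : ℝ => μ (ball 0 (R + c)) / μ (ball 0 R) *
      ((μ (ZSpan.fundamentalDomain b))⁻¹ * ∫⁻ x, g x ∂μ)) atTop
      (𝓝 ((μ (ZSpan.fundamentalDomain b))⁻¹ * ∫⁻ x, g x ∂μ)) := by
    -- The constant factor may be infinite; multiplication passes to the limit because the ratio
    -- tends to `1 ≠ 0`.
    simpa using ENNReal.Tendsto.mul_const (tendsto_measure_ball_add_div μ c)
      (.inl one_ne_zero)
  refine tendsto_of_tendsto_of_tendsto_of_le_of_le (key (-δ)) (key δ) (fun R => ?_) fun R => ?_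
  · have h := measure_ball_mul_lintegral_le μ b hg hδ R
    calc _ = (μ (ball 0 R))⁻¹ * ((μ (ZSpan.fundamentalDomain b))⁻¹ *
          (μ (ball 0 (R - δ)) * ∫⁻ x, g x ∂μ)) := by
            rw [ENNReal.div_eq_inv_mul, sub_eq_add_neg]; ring
      _ ≤ (μ (ball 0 R))⁻¹ * ((μ (ZSpan.fundamentalDomain b))⁻¹ *
          (μ (ZSpan.fundamentalDomain b) * ∫⁻ x in ball 0 R, periodization b g x ∂μ)) := by
            gcongr
      _ = _ := by rw [ENNReal.inv_mul_cancel_left hD0 hDt]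
  · have h := measure_mul_setLIntegral_periodization_le μ b hg hδ R
    calc _ = (μ (ball 0 R))⁻¹ * ((μ (ZSpan.fundamentalDomain b))⁻¹ *
          (μ (ZSpan.fundamentalDomain b) * ∫⁻ x in ball 0 R, periodization b g x ∂μ)) := by
            rw [ENNReal.inv_mul_cancel_left hD0 hDt]
      _ ≤ (μ (ball 0 R))⁻¹ * ((μ (ZSpan.fundamentalDomain b))⁻¹ *
          (μ (ball 0 (R + δ)) * ∫⁻ x, g x ∂μ)) := by gcongr
      _ = _ := by rw [ENNReal.div_eq_inv_mul]; ring

/-- Means over large balls of a sum of periodizations: if the sum lies between two constants and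
its terms are dominated by a summable family, then so does the sum of the means over a period. -/
theorem tsum_mean_periodization_mem_Icc {κ : Type*} [Countable κ]
    (b : κ → Module.Basis ι ℝ E) {g : κ → E → ℝ≥0∞}
    (hg : ∀ j, Measurable (g j)) (B : κ → ℝ≥0∞) (hB : ∑' j, B j ≠ ∞)
    (hgB : ∀ j x, periodization (b j) (g j) x ≤ B j) {c C : ℝ≥0∞}
    (hsum : ∀ x, ∑' j, periodization (b j) (g j) x ∈ Set.Icc c C) :
    ∑' j, (μ (ZSpan.fundamentalDomain (b j)))⁻¹ * ∫⁻ x, g j x ∂μ ∈ Set.Icc c C := by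
  -- The sum over `κ` is treated as an integral for counting measure, so that dominated convergence
  -- applies.
  let _ : MeasurableSpace κ := ⊤
  have hlim := tendsto_lintegral_filter_of_dominated_convergence (μ := Measure.count) (l := atTop)
    (F := fun (R : ℝ) j => (μ (ball 0 R))⁻¹ * ∫⁻ x in ball 0 R, periodization (b j) (g j) x ∂μ)
    (f := fun j => (μ (ZSpan.fundamentalDomain (b j)))⁻¹ * ∫⁻ x, g j x ∂μ) B
    (.of_forall fun _ => measurable_from_top) ?_ ?_
    (.of_forall fun j => tendsto_average_periodization μ (b j) (hg j))
  · simp_rw [lintegral_count] at hlim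
    refine isClosed_Icc.mem_of_tendsto hlim ?_
    filter_upwards [eventually_gt_atTop 0] with R hR
    have h0 : μ (ball (0 : E) R) ≠ 0 := (measure_ball_pos μ _ hR).ne'
    have h1 : μ (ball (0 : E) R) ≠ ∞ := measure_ball_lt_top.ne
    rw [ENNReal.tsum_mul_left, ← lintegral_tsum fun j =>
      (measurable_periodization (b j) (hg j)).aemeasurable]
    have hconst (a : ℝ≥0∞) : (μ (ball (0 : E) R))⁻¹ * ∫⁻ _ in ball (0 : E) R, a ∂μ = a := by
      rw [setLIntegral_const, mul_comm a, ENNReal.inv_mul_cancel_left h0 h1]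
    constructor
    · rw [← hconst c]; gcongr; exact (hsum _).1
    · rw [← hconst C]; gcongr; exact (hsum _).2
  · filter_upwards [eventually_gt_atTop 0] with R hR
    refine .of_forall fun j => ?_
    calc _ ≤ (μ (ball (0 : E) R))⁻¹ * ∫⁻ _ in ball (0 : E) R, B j ∂μ := by
          gcongr; exact hgB _ _
      _ = B j := by
        rw [setLIntegral_const, mul_comm (B j), ENNReal.inv_mul_cancel_left
          (measure_ball_pos μ _ hR).ne' measure_ball_lt_top.ne]
  · rwa [lintegral_count]

end LatticeAverage

/-! ### Invertible matrices, changes of variables and lattices. -/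

section Linear

variable {d : ℕ}

/-- The action of an invertible matrix on `ℝ^d` as a continuous linear equivalence. -/
def actEquiv (M : GL (Fin d) ℝ) : Space d ≃L[ℝ] Space d :=
  LinearEquiv.toContinuousLinearEquiv <|
    LinearEquiv.ofLinearMap (Matrix.toEuclideanLin (M : Matrix (Fin d) (Fin d) ℝ))
      (Matrix.toEuclideanLin ((M⁻¹ : GL (Fin d) ℝ) : Matrix (Fin d) (Fin d) ℝ))
      (LinearMap.ext fun x => by
        change act _ (act _ x) = x
        rw [← act_mul, ← Units.val_mul, mul_inv_cancel, Units.val_one, act_one])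
      (LinearMap.ext fun x => by
        change act _ (act _ x) = x
        rw [← act_mul, ← Units.val_mul, inv_mul_cancel, Units.val_one, act_one])

@[simp]
theorem actEquiv_apply (M : GL (Fin d) ℝ) (x : Space d) : actEquiv M x = act M x := rfl

theorem act_inv_act (M : GL (Fin d) ℝ) (x : Space d) :
    act ((M⁻¹ : GL (Fin d) ℝ) : Matrix (Fin d) (Fin d) ℝ) (act M x) = x :=
  (actEquiv M).symm_apply_apply x

theorem continuous_act (M : Matrix (Fin d) (Fin d) ℝ) : Continuous (act M) :=
  (Matrix.toEuclideanLin M).continuous_of_finiteDimensional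

theorem act_sub (M : Matrix (Fin d) (Fin d) ℝ) (x y : Space d) :
    act M (x - y) = act M x - act M y :=
  map_sub (Matrix.toEuclideanLin M) x y

theorem inner_act (M : Matrix (Fin d) (Fin d) ℝ) (x y : Space d) :
    inner ℝ (act M x) y = inner ℝ x (act M.transpose y) := by
  simp only [act, Matrix.toLpLin_apply, EuclideanSpace.inner_eq_star_dotProduct, star_trivial]
  rw [Matrix.mulVec_transpose, Matrix.dotProduct_mulVec]

theorem det_ne_zero (M : GL (Fin d) ℝ) : (M : Matrix (Fin d) (Fin d) ℝ).det ≠ 0 :=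
  (M.isUnit.map Matrix.detMonoidHom).ne_zero

theorem abs_det_pos (M : GL (Fin d) ℝ) : 0 < |(M : Matrix (Fin d) (Fin d) ℝ).det| :=
  abs_pos.mpr (det_ne_zero M)

theorem det_toEuclideanLin (M : Matrix (Fin d) (Fin d) ℝ) :
    LinearMap.det (Matrix.toEuclideanLin M) = M.det := by
  rw [Matrix.toEuclideanLin, Matrix.toLpLin_eq_toLin, LinearMap.det_toLin]

theorem map_act_volume (M : GL (Fin d) ℝ) :
    (volume : Measure (Space d)).map (actEquiv M) =
      ENNReal.ofReal |(M : Matrix (Fin d) (Fin d) ℝ).det|⁻¹ • volume := by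
  have h := Measure.map_linearMap_addHaar_eq_smul_addHaar (volume : Measure (Space d))
    (f := Matrix.toEuclideanLin (M : Matrix (Fin d) (Fin d) ℝ))
    (by rw [det_toEuclideanLin]; exact det_ne_zero M)
  rwa [det_toEuclideanLin, abs_inv] at h

theorem lintegral_comp_act (M : GL (Fin d) ℝ) (g : Space d → ℝ≥0∞) :
    ∫⁻ x, g (act M x) = ENNReal.ofReal |(M : Matrix (Fin d) (Fin d) ℝ).det|⁻¹ * ∫⁻ x, g x := by
  have h := (actEquiv M).toHomeomorph.measurableEmbedding.lintegral_map (μ := volume) g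
  rw [← smul_eq_mul, ← lintegral_smul_measure, ← map_act_volume]
  exact h.symm

theorem integral_comp_act (M : GL (Fin d) ℝ) (g : Space d → ℂ) :
    ∫ x, g (act M x) = |(M : Matrix (Fin d) (Fin d) ℝ).det|⁻¹ • ∫ x, g x := by
  have h := (actEquiv M).toHomeomorph.measurableEmbedding.integral_map (μ := volume) g
  rw [← ENNReal.toReal_ofReal (inv_nonneg.mpr (abs_nonneg _)), ← integral_smul_measure,
    ← map_act_volume]
  exact h.symm

/-- The image of the standard basis under an invertible matrix. -/
def latticeBasis (M : GL (Fin d) ℝ) : Module.Basis (Fin d) ℝ (Space d) :=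
  (EuclideanSpace.basisFun (Fin d) ℝ).toBasis.map (actEquiv M).toLinearEquiv

theorem latticeBasis_apply (M : GL (Fin d) ℝ) (i : Fin d) :
    latticeBasis M i = act M (EuclideanSpace.basisFun (Fin d) ℝ i) := by
  simp [latticeBasis]

/-- An integer vector as a point of `ℝ^d`. -/
def intVec (k : Fin d → ℤ) : Space d := WithLp.toLp 2 fun n => (k n : ℝ)

theorem sum_smul_latticeBasis (M : GL (Fin d) ℝ) (k : Fin d → ℤ) :
    ∑ i, k i • latticeBasis M i = act M (intVec k) := by
  have h : intVec k = ∑ i, k i • EuclideanSpace.basisFun (Fin d) ℝ i := by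
    ext n
    simp [intVec, Pi.single_apply]
  rw [h]
  simp only [latticeBasis_apply]
  change _ = Matrix.toEuclideanLin _ _
  rw [map_sum]
  simp only [map_zsmul]
  rfl

theorem volume_fundamentalDomain_latticeBasis (M : GL (Fin d) ℝ) :
    volume (ZSpan.fundamentalDomain (latticeBasis M)) =
      ENNReal.ofReal |(M : Matrix (Fin d) (Fin d) ℝ).det| := by
  rw [ZSpan.measure_fundamentalDomain _ _ (EuclideanSpace.basisFun (Fin d) ℝ).toBasis,
    measure_congr (ZSpan.fundamentalDomain_ae_parallelepiped _ _)]
  have h1 : volume (parallelepiped (EuclideanSpace.basisFun (Fin d) ℝ).toBasis) = 1 := by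
    simpa using (EuclideanSpace.basisFun (Fin d) ℝ).volume_parallelepiped
  rw [h1, mul_one, latticeBasis]
  have h2 : ⇑((EuclideanSpace.basisFun (Fin d) ℝ).toBasis.map (actEquiv M).toLinearEquiv) =
      Matrix.toEuclideanLin (M : Matrix (Fin d) (Fin d) ℝ) ∘
        (EuclideanSpace.basisFun (Fin d) ℝ).toBasis := by
    ext1 i
    simp
    rfl
  rw [h2, Module.Basis.det_comp, Module.Basis.det_self, mul_one, det_toEuclideanLin]

/-- Distinct points of a lattice have disjoint small neighbourhoods. -/
theorem exists_lattice_separation (P : GL (Fin d) ℝ) :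
    ∃ r > 0, ∀ k k' : Fin d → ℤ, ∀ x : Space d,
      ‖x - act P (intVec k)‖ < r → ‖x - act P (intVec k')‖ < r → k = k' := by
  obtain ⟨C, hC, hP⟩ := (actEquiv P).symm.toContinuousLinearMap.isBoundedLinearMap.bound
  -- `C` bounds the norm of `P⁻¹`: lattice points closer than `1 / C` come from integer vectors
  -- closer than `1`, which are equal.
  refine ⟨1 / (2 * C), by positivity, fun k k' x hk hk' => ?_⟩
  by_contra hne
  obtain ⟨i, hi⟩ := Function.ne_iff.mp hne
  have h1 : ‖act P (intVec k) - act P (intVec k')‖ < 1 / C := by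
    calc _ = ‖(x - act P (intVec k')) - (x - act P (intVec k))‖ := by congr 1; abel
      _ ≤ ‖x - act P (intVec k')‖ + ‖x - act P (intVec k)‖ := norm_sub_le _ _
      _ < 1 / (2 * C) + 1 / (2 * C) := by gcongr
      _ = 1 / C := by field_simp; norm_num
  have h2 := hP (act P (intVec k) - act P (intVec k'))
  rw [← act_sub] at h1 h2
  have h3 : ‖intVec k - intVec k'‖ < 1 := by
    have h4 : (actEquiv P).symm (act P (intVec k - intVec k')) = intVec k - intVec k' :=
      (actEquiv P).symm_apply_apply _
    rw [ContinuousLinearEquiv.coe_coe, h4] at h2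
    calc _ ≤ _ := h2
      _ < C * (1 / C) := by gcongr
      _ = 1 := by field_simp
  have h4 := PiLp.norm_apply_le (intVec k - intVec k') i
  have h5 : (1 : ℝ) ≤ ‖(intVec k - intVec k') i‖ := by
    have : (1 : ℤ) ≤ |k i - k' i| := Int.one_le_abs (sub_ne_zero.mpr hi)
    simp only [intVec, PiLp.sub_apply, Real.norm_eq_abs]
    exact_mod_cast this
  linarith

end Linear

/-! ### Topology and Haar measure of `G`; sampling against the maximal function. -/

section Group

variable {d : ℕ} {A : GL (Fin d) ℝ}

namespace AffGroup

theorem isEmbedding_mk (h : Subgroup.zpowers A) :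
    IsEmbedding fun x : Space d => (⟨x, h⟩ : AffGroup A) := by
  refine ⟨⟨?_⟩, fun x y hxy => congrArg trans hxy⟩
  change _ = TopologicalSpace.induced _ (_ ⊓ _)
  rw [induced_inf, induced_compose, induced_compose]
  change _ = TopologicalSpace.induced id _ ⊓ TopologicalSpace.induced (fun _ => h) ⊥
  rw [induced_id, @induced_const _ _ ⊥, inf_top_eq]

/-- The fibre over `h` is open because `⟨A⟩` is discrete. -/
theorem measurableEmbedding_mk (h : Subgroup.zpowers A) :
    MeasurableEmbedding fun x : Space d => (⟨x, h⟩ : AffGroup A) := by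
  refine (isEmbedding_mk h).measurableEmbedding ?_
  have h1 : Set.range (fun x : Space d => (⟨x, h⟩ : AffGroup A)) = dil ⁻¹' {h} := by
    ext g
    exact ⟨fun ⟨x, hx⟩ => hx ▸ rfl, fun hg => ⟨g.trans, AffGroup.ext rfl (Eq.symm hg)⟩⟩
  rw [h1]
  refine IsOpen.measurableSet ?_
  have h2 : IsOpen[TopologicalSpace.induced (dil (A := A)) ⊥] (dil ⁻¹' {h}) :=
    ⟨{h}, trivial, rfl⟩
  exact (inf_le_right : (inferInstance : TopologicalSpace (AffGroup A)) ≤ _) _ h2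

/-- No measurability of `Φ` is needed because the fibre inclusions are measurable embeddings. This
permits using maximal functions without proving them measurable. -/
theorem lintegral_haar (Φ : AffGroup A → ℝ≥0∞) :
    ∫⁻ g, Φ g ∂haar A = ∑' h : Subgroup.zpowers A,
      ENNReal.ofReal |((h : GL (Fin d) ℝ) : Matrix (Fin d) (Fin d) ℝ).det|⁻¹ *
        ∫⁻ x, Φ ⟨x, h⟩ := by
  rw [haar, lintegral_sum_measure]
  refine tsum_congr fun h => ?_
  rw [lintegral_smul_measure, smul_eq_mul, (measurableEmbedding_mk h).lintegral_map]

instance : Countable (Subgroup.zpowers A) :=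
  (Set.countable_range (A ^ · : ℤ → GL (Fin d) ℝ)).to_subtype

theorem aestronglyMeasurable_haar {F : AffGroup A → ℂ}
    (hF : ∀ h : Subgroup.zpowers A, AEStronglyMeasurable (fun x => F ⟨x, h⟩) volume) :
    AEStronglyMeasurable F (haar A) :=
  AEStronglyMeasurable.sum_measure fun h =>
    AEStronglyMeasurable.smul_measure
      ((measurableEmbedding_mk h).aestronglyMeasurable_map_iff.mpr (hF h)) _

theorem mk_mul_mk_one (x q : Space d) (h : Subgroup.zpowers A) :
    (⟨x, h⟩ * ⟨q, 1⟩ : AffGroup A) = ⟨x + act (h : GL (Fin d) ℝ) q, h⟩ :=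
  AffGroup.ext rfl (mul_one h)

theorem exists_ball_subset {Q : Set (AffGroup A)} (hQ : Q ∈ 𝓝 (1 : AffGroup A)) :
    ∃ r > 0, ∀ q : Space d, ‖q‖ < r → (⟨q, 1⟩ : AffGroup A) ∈ Q := by
  have h : ∀ᶠ q in 𝓝 (0 : Space d), (⟨q, 1⟩ : AffGroup A) ∈ Q :=
    (isEmbedding_mk (A := A) 1).continuous.continuousAt.eventually hQ
  obtain ⟨r, hr, hb⟩ := Metric.eventually_nhds_iff.mp h
  exact ⟨r, hr, fun q hq => hb (by simpa using hq)⟩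

end AffGroup

theorem enorm_le_maximalFunction {G : Type*} [Mul G] {Q : Set G} (F : G → ℂ) (g : G) {q : G}
    (hq : q ∈ Q) : ‖F (g * q)‖ₑ ≤ maximalFunction Q F g :=
  le_iSup₂ (f := fun q _ => ‖F (g * q)‖ₑ) q hq

/-- The values of `F` on a translated lattice are controlled by the local maximal function. -/
theorem tsum_sq_le_lintegral_maximalFunction (P : GL (Fin d) ℝ) {Q : Set (AffGroup A)} {r : ℝ}
    (hrQ : ∀ q : Space d, ‖q‖ < r → (⟨q, 1⟩ : AffGroup A) ∈ Q)
    (hrP : ∀ k k' : Fin d → ℤ, ∀ x : Space d,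
      ‖x - act P (intVec k)‖ < r → ‖x - act P (intVec k')‖ < r → k = k')
    (F : AffGroup A → ℂ) (h : Subgroup.zpowers A) (x : Space d) :
    volume (Metric.ball (0 : Space d) r) * ∑' k : Fin d → ℤ,
        ‖F ⟨x + act (h : GL (Fin d) ℝ) (act P (intVec k)), h⟩‖ₑ ^ 2 ≤
      ENNReal.ofReal |((h : GL (Fin d) ℝ) : Matrix (Fin d) (Fin d) ℝ).det|⁻¹ *
        ∫⁻ y, maximalFunction Q F ⟨y, h⟩ ^ 2 := by
  set H : GL (Fin d) ℝ := h.val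
  set z : (Fin d → ℤ) → Space d := fun k => act P (intVec k)
  -- Before dilation by `H` the balls of radius `r` about the points `z k` are disjoint, so at most
  -- one term survives. For it, `(x + H z_k, h) = (x + H y, h)(z_k - y, 1)` with `(z_k - y, 1) ∈ Q`.
  -- Using `y` instead of `H y` as variable keeps `r` independent of `h`, and its Jacobian supplies
  -- the Haar weight.
  have key (y : Space d) :
      ∑' k, ‖F ⟨x + act H (z k), h⟩‖ₑ ^ 2 * (Metric.ball (z k) r).indicator 1 y ≤
        maximalFunction Q F ⟨x + act H y, h⟩ ^ 2 := by
    by_cases hy : ∃ k, y ∈ Metric.ball (z k) r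
    · obtain ⟨k, hk⟩ := hy
      rw [tsum_eq_single k fun k' hk' => ?_]
      · rw [Set.indicator_of_mem hk, Pi.one_apply, mul_one]
        gcongr
        rw [Metric.mem_ball, dist_comm, dist_eq_norm] at hk
        have : (⟨x + act H (z k), h⟩ : AffGroup A) = ⟨x + act H y, h⟩ * ⟨z k - y, 1⟩ := by
          rw [AffGroup.mk_mul_mk_one, add_assoc, ← act_add, add_sub_cancel]
        rw [this]
        exact enorm_le_maximalFunction F _ (hrQ _ hk)
      · rw [Set.indicator_of_notMem, mul_zero]
        intro hk''
        rw [Metric.mem_ball, dist_eq_norm] at hk hk''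
        exact hk' (hrP _ _ _ hk'' hk)
    · push Not at hy
      have : ∀ k, ‖F ⟨x + act H (z k), h⟩‖ₑ ^ 2 * (Metric.ball (z k) r).indicator 1 y = 0 :=
        fun k => by rw [Set.indicator_of_notMem (hy k), mul_zero]
      simp [this]
  rw [← lintegral_add_left_eq_self _ x,
    ← lintegral_comp_act H (fun y => maximalFunction Q F ⟨x + y, h⟩ ^ 2)]
  refine le_trans (le_of_eq ?_) (lintegral_mono key)
  rw [lintegral_tsum fun k =>
    ((measurable_one.indicator Metric.isOpen_ball.measurableSet).const_mul _).aemeasurable,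
    ← ENNReal.tsum_mul_left]
  refine tsum_congr fun k => ?_
  rw [lintegral_const_mul _ (measurable_one.indicator Metric.isOpen_ball.measurableSet),
    lintegral_indicator_one Metric.isOpen_ball.measurableSet, mul_comm,
    Measure.addHaar_ball_center volume (z k)]

end Group

/-! ### From the discrete frame to the continuous frame. -/

section Representation

variable {d : ℕ} {A : GL (Fin d) ℝ}

theorem quasiReg_ae (g : AffGroup A) (ψ : L2Space d) :
    (quasiReg g ψ : Space d → ℂ) =ᵐ[volume] fun t =>
      ((|g.mat.det| ^ (-(1 / 2) : ℝ) : ℝ) : ℂ) * ψ (act g.matInv (t - g.trans)) :=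
  MemLp.coeFn_toLp _

theorem inner_quasiReg (g : AffGroup A) (ψ f : L2Space d) :
    inner ℂ (quasiReg g ψ) f = ∫ t, inner ℂ
      (((|g.mat.det| ^ (-(1 / 2) : ℝ) : ℝ) : ℂ) * ψ (act g.matInv (t - g.trans))) (f t) := by
  rw [L2.inner_def]
  refine integral_congr_ae ?_
  filter_upwards [quasiReg_ae g ψ] with t ht
  rw [ht]

/-- Translation by `-x` on `L²(ℝ^d)`: the function `t ↦ f (t + x)`. -/
def shift (x : Space d) (f : L2Space d) : L2Space d :=
  Lp.compMeasurePreserving (fun t => t + x) (measurePreserving_add_right volume x) f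

theorem norm_shift (x : Space d) (f : L2Space d) : ‖shift x f‖ = ‖f‖ :=
  Lp.norm_compMeasurePreserving f (measurePreserving_add_right volume x)

/-- This turns the frame inequality for a translate of `f` into one for `f` sampled on a translated
lattice. -/
theorem inner_quasiReg_shift (x y : Space d) (h : Subgroup.zpowers A) (ψ f : L2Space d) :
    inner ℂ (quasiReg (⟨y, h⟩ : AffGroup A) ψ) (shift x f) =
      inner ℂ (quasiReg (⟨x + y, h⟩ : AffGroup A) ψ) f := by
  rw [inner_quasiReg, inner_quasiReg]
  conv_rhs => rw [← integral_add_right_eq_self _ x]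
  refine integral_congr_ae ?_
  filter_upwards [Lp.coeFn_compMeasurePreserving f (measurePreserving_add_right volume x)]
    with t ht
  have h1 : (shift x f : Space d → ℂ) t = f (t + x) := ht
  have h2 : t + x - (x + y) = t - y := by abel
  simp only [h1, h2]
  rfl

theorem stronglyMeasurable_inner_quasiReg (h : Subgroup.zpowers A) (ψ f : L2Space d) :
    StronglyMeasurable fun x : Space d => (inner ℂ (quasiReg (⟨x, h⟩ : AffGroup A) ψ) f : ℂ) := by
  simp_rw [inner_quasiReg]
  have h1 : Measurable fun p : Space d × Space d =>
      act (AffGroup.mk (A := A) 0 h).matInv (p.2 - p.1) :=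
    (continuous_act _).measurable.comp (measurable_snd.sub measurable_fst)
  have h2 : StronglyMeasurable fun p : Space d × Space d =>
      (((|(AffGroup.mk (A := A) 0 h).mat.det| ^ (-(1 / 2) : ℝ) : ℝ) : ℂ)) *
        ψ (act (AffGroup.mk (A := A) 0 h).matInv (p.2 - p.1)) :=
    ((Lp.stronglyMeasurable ψ).comp_measurable h1).const_mul _
  exact (h2.inner (𝕜 := ℂ)
    ((Lp.stronglyMeasurable f).comp_measurable measurable_snd)).integral_prod_right'

theorem nontrivial_L2Space : Nontrivial (L2Space d) := by
  have hb : volume (Metric.ball (0 : Space d) 1) ≠ ∞ := measure_ball_lt_top.ne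
  refine ⟨indicatorConstLp 2 Metric.isOpen_ball.measurableSet hb (1 : ℂ), 0, fun h => ?_⟩
  have h1 := norm_indicatorConstLp (p := 2) (μ := volume) (c := (1 : ℂ)) two_ne_zero
    ENNReal.ofNat_ne_top (hs := Metric.isOpen_ball.measurableSet) (hμs := hb)
  rw [h, norm_zero, norm_one, one_mul] at h1
  refine (Real.rpow_pos_of_pos ?_ _).ne h1
  exact ENNReal.toReal_pos (Metric.measure_ball_pos volume _ one_pos).ne' hb

/-- A discrete wavelet system can only be a frame if the dilation has infinite order. -/
theorem zpow_injective_of_isFrame {P : GL (Fin d) ℝ} {ψ : L2Space d} {C₁ C₂ : ℝ}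
    (hF : IsFrame (discreteSystem A P ψ) C₁ C₂) : Function.Injective fun j : ℤ => A ^ j := by
  rw [injective_zpow_iff_not_isOfFinOrder]
  intro hA
  obtain ⟨n, hn, hAn⟩ := isOfFinOrder_iff_pow_eq_one.mp hA
  obtain ⟨hC, -, hF⟩ := hF
  obtain ⟨f, hf⟩ := @exists_ne _ nontrivial_L2Space (0 : L2Space d)
  obtain ⟨h1, h2⟩ := hF f
  have hpos : ∑' i, ‖(inner ℂ (discreteSystem A P ψ i) f : ℂ)‖ₑ ^ 2 ≠ 0 := fun h0 => by
    rw [h0, nonpos_iff_eq_zero, ENNReal.ofReal_eq_zero] at h1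
    have := norm_pos_iff.mpr hf
    exact absurd h1 (not_le.mpr (by positivity))
  obtain ⟨i, hi⟩ : ∃ i, ‖(inner ℂ (discreteSystem A P ψ i) f : ℂ)‖ₑ ^ 2 ≠ 0 := by
    by_contra! h
    exact hpos (ENNReal.tsum_eq_zero.mpr h)
  have hinj : Function.Injective fun m : ℤ => ((i.1 + n * m, i.2) : ℤ × (Fin d → ℤ)) := by
    intro m m' hm
    have := (Prod.ext_iff.mp hm).1
    simpa [hn.ne'] using this
  have hle := ENNReal.tsum_comp_le_tsum_of_injective hinj
    (fun i => ‖(inner ℂ (discreteSystem A P ψ i) f : ℂ)‖ₑ ^ 2)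
  -- With `A ^ n = 1`, a vector having nonzero coefficient recurs infinitely often, which makes the
  -- frame sum infinite.
  have hconst (m : ℤ) : discreteSystem A P ψ (i.1 + n * m, i.2) = discreteSystem A P ψ i := by
    have hz : A ^ (i.1 + n * m) = A ^ i.1 := by
      rw [zpow_add, zpow_mul, zpow_natCast, hAn, one_zpow, mul_one]
    unfold discreteSystem latticePoint
    simp only [hz]
  simp only [hconst] at hle
  rw [ENNReal.tsum_const_eq_top_of_ne_zero hi] at hle
  exact absurd (hle.trans h2) (by simp)

/-- Infinite order of `A` is essential: otherwise the sum over `ℤ` would count each element of `⟨A⟩`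
repeatedly. -/
theorem tsum_discreteSystem {P : GL (Fin d) ℝ} (hA : Function.Injective fun j : ℤ => A ^ j)
    (ψ f : L2Space d) :
    ∑' i, ‖(inner ℂ (discreteSystem A P ψ i) f : ℂ)‖ₑ ^ 2 =
      ∑' h : Subgroup.zpowers A, ∑' k : Fin d → ℤ,
        ‖(inner ℂ (quasiReg (⟨act (h : GL (Fin d) ℝ) (act P (intVec k)), h⟩ : AffGroup A) ψ) f
          : ℂ)‖ₑ ^ 2 := by
  rw [ENNReal.tsum_prod', ← (Equiv.ofBijective (fun j : ℤ =>
    (⟨A ^ j, j, rfl⟩ : Subgroup.zpowers A)) ⟨fun j j' h => hA (congrArg Subtype.val h),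
      fun ⟨_, j, hj⟩ => ⟨j, Subtype.ext hj⟩⟩).tsum_eq]
  rfl

theorem periodization_latticeBasis (M : GL (Fin d) ℝ) (g : Space d → ℝ≥0∞) (x : Space d) :
    periodization (latticeBasis M) g x = ∑' k : Fin d → ℤ, g (x + act M (intVec k)) := by
  simp_rw [periodization, sum_smul_latticeBasis]

theorem lintegral_waveletTransform_mem_Icc {P : GL (Fin d) ℝ} {ψ : L2Space d}
    (hψ : ψ ∈ besselSpace A) {C₁ C₂ : ℝ} (hF : IsFrame (discreteSystem A P ψ) C₁ C₂)
    (f : L2Space d) :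
    ∫⁻ g, ‖(inner ℂ (quasiReg g ψ) f : ℂ)‖ₑ ^ 2 ∂AffGroup.haar A ∈
      Set.Icc (ENNReal.ofReal (C₁ * |(P : Matrix (Fin d) (Fin d) ℝ).det| * ‖f‖ ^ 2))
        (ENNReal.ofReal (C₂ * |(P : Matrix (Fin d) (Fin d) ℝ).det| * ‖f‖ ^ 2)) := by
  have hA := zpow_injective_of_isFrame hF
  obtain ⟨-, Q, -, hQ, hfin⟩ := hψ f
  obtain ⟨r₁, hr₁, hrQ⟩ := AffGroup.exists_ball_subset hQ
  obtain ⟨r₂, hr₂, hrP⟩ := exists_lattice_separation P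
  obtain ⟨r, hr, hr1, hr2⟩ : ∃ r > 0, r ≤ r₁ ∧ r ≤ r₂ :=
    ⟨min r₁ r₂, lt_min hr₁ hr₂, min_le_left _ _, min_le_right _ _⟩
  set V := volume (Metric.ball (0 : Space d) r)
  have hV0 : V ≠ 0 := (Metric.measure_ball_pos volume _ hr).ne'
  have hVt : V ≠ ∞ := measure_ball_lt_top.ne
  set b : Subgroup.zpowers A → Module.Basis (Fin d) ℝ (Space d) :=
    fun h => latticeBasis (h.val * P)
  set g : Subgroup.zpowers A → Space d → ℝ≥0∞ :=
    fun h x => ‖(inner ℂ (quasiReg (⟨x, h⟩ : AffGroup A) ψ) f : ℂ)‖ₑ ^ 2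
  have hg (h) : Measurable (g h) :=
    (stronglyMeasurable_inner_quasiReg h ψ f).measurable.enorm.pow_const 2
  have hper (h) (x : Space d) : periodization (b h) (g h) x = ∑' k : Fin d → ℤ,
      ‖waveletTransform A ψ f ⟨x + act h.val (act P (intVec k)), h⟩‖ₑ ^ 2 := by
    simp only [b, g, periodization_latticeBasis, Units.val_mul, act_mul]
    rfl
  -- The dominating terms sum to `V⁻¹` times the integral over `G` of the squared maximal function.
  have hmean := tsum_mean_periodization_mem_Icc volume b hg
    (fun h => V⁻¹ * (ENNReal.ofReal |((h : GL (Fin d) ℝ) : Matrix (Fin d) (Fin d) ℝ).det|⁻¹ *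
      ∫⁻ y, maximalFunction Q (waveletTransform A ψ f) ⟨y, h⟩ ^ 2))
    (by
      rw [ENNReal.tsum_mul_left, ← AffGroup.lintegral_haar
        (fun g => maximalFunction Q (waveletTransform A ψ f) g ^ 2)]
      exact ENNReal.mul_ne_top (ENNReal.inv_ne_top.mpr hV0) hfin.ne)
    (fun h x => by
      rw [hper, ← ENNReal.inv_mul_cancel_left hV0 hVt (b := tsum _)]
      exact mul_le_mul_right (tsum_sq_le_lintegral_maximalFunction P
        (fun q hq => hrQ q (hq.trans_le hr1))
        (fun k k' y hk hk' => hrP k k' y (hk.trans_le hr2) (hk'.trans_le hr2)) _ h x) _)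
    (c := ENNReal.ofReal (C₁ * ‖f‖ ^ 2)) (C := ENNReal.ofReal (C₂ * ‖f‖ ^ 2))
    (fun x => by
      have := hF.2.2 (shift x f)
      rw [norm_shift, tsum_discreteSystem hA] at this
      simp_rw [inner_quasiReg_shift] at this
      simp_rw [hper]
      exact this)
  have hp := abs_det_pos P
  have hp0 : ENNReal.ofReal |(P : Matrix (Fin d) (Fin d) ℝ).det| ≠ 0 := by simpa using hp
  -- A period of `hPℤ^d` has volume `|det h| |det P|`; the inverse of the first factor is the Haar
  -- weight.
  have hsum : ∑' h, (volume (ZSpan.fundamentalDomain (b h)))⁻¹ * ∫⁻ x, g h x =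
      (ENNReal.ofReal |(P : Matrix (Fin d) (Fin d) ℝ).det|)⁻¹ *
        ∫⁻ g, ‖(inner ℂ (quasiReg g ψ) f : ℂ)‖ₑ ^ 2 ∂AffGroup.haar A := by
    rw [AffGroup.lintegral_haar, ← ENNReal.tsum_mul_left]
    refine tsum_congr fun h => ?_
    rw [volume_fundamentalDomain_latticeBasis, Units.val_mul, Matrix.det_mul, abs_mul,
      ENNReal.ofReal_mul (abs_nonneg _), ENNReal.ofReal_inv_of_pos (abs_det_pos _),
      ENNReal.mul_inv (.inl (by simpa using abs_det_pos h.val)) (.inl ENNReal.ofReal_ne_top),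
      mul_comm (_)⁻¹, mul_assoc]
  rw [hsum] at hmean
  have hcancel (a : ℝ) : ENNReal.ofReal (a * |(P : Matrix (Fin d) (Fin d) ℝ).det| * ‖f‖ ^ 2) =
      ENNReal.ofReal |(P : Matrix (Fin d) (Fin d) ℝ).det| * ENNReal.ofReal (a * ‖f‖ ^ 2) := by
    rw [← ENNReal.ofReal_mul hp.le]; congr 1; ring
  rw [hcancel, hcancel]
  constructor
  · calc _ ≤ _ := mul_le_mul_right hmean.1 _
      _ = _ := ENNReal.mul_inv_cancel_left hp0 ENNReal.ofReal_ne_top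
  · calc _ = _ := (ENNReal.mul_inv_cancel_left hp0 ENNReal.ofReal_ne_top).symm
      _ ≤ _ := mul_le_mul_right hmean.2 _

theorem isContinuousFrame_of_isFrame {P : GL (Fin d) ℝ} {ψ : L2Space d}
    (hψ : ψ ∈ besselSpace A) {C₁ C₂ : ℝ} (hF : IsFrame (discreteSystem A P ψ) C₁ C₂) :
    IsContinuousFrame (AffGroup.haar A) (semiContinuousSystem A ψ)
      (C₁ * |(P : Matrix (Fin d) (Fin d) ℝ).det|) (C₂ * |(P : Matrix (Fin d) (Fin d) ℝ).det|) :=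
  ⟨mul_pos hF.1 (abs_det_pos P), mul_le_mul_of_nonneg_right hF.2.1 (abs_nonneg _), fun f =>
    ⟨AffGroup.aestronglyMeasurable_haar fun h =>
      (stronglyMeasurable_inner_quasiReg h ψ f).aestronglyMeasurable,
      lintegral_waveletTransform_mem_Icc hψ hF f⟩⟩

end Representation

/-! ### The representation on the Fourier side and the Calderón sum. -/

section Fourier

variable {d : ℕ} {A : GL (Fin d) ℝ}

theorem integral_smul_fourier_L2 (u : L2Space d) (φ : SchwartzMap (Space d) ℂ) :
    ∫ x, φ x * (𝓕 u : L2Space d) x = ∫ x, (𝓕 (φ : Space d → ℂ)) x * u x := by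
  have h := congrArg (fun T => T φ) (Lp.fourier_toTemperedDistribution_eq u)
  simp only [TemperedDistribution.fourier_apply, Lp.toTemperedDistribution_apply, smul_eq_mul,
    SchwartzMap.fourier_coe] at h
  exact h.symm

/-- A locally integrable function which pairs with test functions like the Fourier transform of
`u` is the Fourier transform of `u`. -/
theorem fourier_L2_ae_eq {u : L2Space d} {w : Space d → ℂ} (hw : LocallyIntegrable w volume)
    (h : ∀ φ : SchwartzMap (Space d) ℂ, HasCompactSupport φ →
      ∫ x, (𝓕 (φ : Space d → ℂ)) x * u x = ∫ x, φ x * w x) :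
    (𝓕 u : L2Space d) =ᵐ[volume] w := by
  refine ae_eq_of_integral_contDiff_smul_eq
    ((Lp.memLp (𝓕 u : L2Space d)).locallyIntegrable one_le_two) hw fun g hg hgs => ?_
  have hg' : HasCompactSupport fun x => (g x : ℂ) := hgs.comp_left Complex.ofReal_zero
  have hφ := h (hg'.toSchwartzMap (Complex.ofRealCLM.contDiff.comp hg)) hg'
  rw [← integral_smul_fourier_L2] at hφ
  exact hφ

/-- On integrable functions, the Fourier transform on `L²` is given by the Fourier integral. -/
theorem fourier_toLp_ae_eq {u : Space d → ℂ} (hu : Integrable u) (hu2 : MemLp u 2 volume) :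
    (𝓕 (hu2.toLp u) : L2Space d) =ᵐ[volume] 𝓕 u := by
  have hcont : Continuous (𝓕 u) :=
    VectorFourier.fourierIntegral_continuous Real.continuous_fourierChar continuous_inner hu
  refine fourier_L2_ae_eq hcont.locallyIntegrable fun φ _ => ?_
  have h := VectorFourier.integral_fourierIntegral_smul_eq_flip (L := innerₗ (Space d))
    (μ := volume) (ν := volume) Real.continuous_fourierChar continuous_inner
    (φ.integrable (μ := volume)) hu
  simp only [flip_innerₗ, smul_eq_mul] at h
  refine Eq.trans (integral_congr_ae ?_) h
  filter_upwards [hu2.coeFn_toLp] with x hx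
  rw [hx]
  rfl

theorem enorm_sq_eq_lintegral (f : L2Space d) : ‖f‖ₑ ^ 2 = ∫⁻ x, ‖f x‖ₑ ^ 2 := by
  have h := eLpNorm_nnreal_pow_eq_lintegral (f := f) (μ := volume) (p := 2) two_ne_zero
  simpa [Lp.enorm_def] using h

/-- Plancherel's theorem for the Fourier integral. -/
theorem lintegral_enorm_fourier_sq {u : Space d → ℂ} (hu : Integrable u)
    (hu2 : MemLp u 2 volume) : ∫⁻ x, ‖𝓕 u x‖ₑ ^ 2 = ∫⁻ x, ‖u x‖ₑ ^ 2 := by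
  have h1 : ‖(𝓕 (hu2.toLp u) : L2Space d)‖ₑ ^ 2 = ‖hu2.toLp u‖ₑ ^ 2 := by
    rw [← ofReal_norm, Lp.norm_fourier_eq, ofReal_norm]
  rw [enorm_sq_eq_lintegral, enorm_sq_eq_lintegral] at h1
  calc _ = _ := lintegral_congr_ae ((fourier_toLp_ae_eq hu hu2).mono fun x hx => by simp only [hx])
    _ = _ := h1
    _ = _ := lintegral_congr_ae (hu2.coeFn_toLp.mono fun x hx => by simp only [hx])

/-- The transpose of an invertible matrix. -/
def transposeGL (M : GL (Fin d) ℝ) : GL (Fin d) ℝ where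
  val := (M : Matrix (Fin d) (Fin d) ℝ).transpose
  inv := ((M⁻¹ : GL (Fin d) ℝ) : Matrix (Fin d) (Fin d) ℝ).transpose
  val_inv := by rw [← Matrix.transpose_mul, ← Units.val_mul]; simp
  inv_val := by rw [← Matrix.transpose_mul, ← Units.val_mul]; simp

@[simp]
theorem transposeGL_val (M : GL (Fin d) ℝ) :
    (transposeGL M : Matrix (Fin d) (Fin d) ℝ) = (M : Matrix (Fin d) (Fin d) ℝ).transpose := rfl

/-- The function `ξ ↦ e^{-2πi ⟨ξ, x⟩}`. -/
def character (x ξ : Space d) : ℂ := Complex.exp (↑(-2 * Real.pi * inner ℝ ξ x) * Complex.I)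

theorem norm_character (x ξ : Space d) : ‖character x ξ‖ = 1 :=
  Complex.norm_exp_ofReal_mul_I _

theorem contDiff_character (x : Space d) : ContDiff ℝ (⊤ : ℕ∞) (character x) := by
  unfold character
  refine ContDiff.cexp (ContDiff.mul (Complex.ofRealCLM.contDiff.comp ?_) contDiff_const)
  exact contDiff_const.mul (contDiff_id.inner ℝ contDiff_const)

theorem fourier_eq_integral_character (u : Space d → ℂ) (x : Space d) :
    𝓕 u x = ∫ ξ, character x ξ * u ξ := by
  rw [Real.fourier_eq']
  rfl

theorem character_add (x y ξ : Space d) :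
    character (x + y) ξ = character x ξ * character y ξ := by
  simp only [character, ← Complex.exp_add, inner_add_right]
  push_cast
  ring_nf

theorem character_act (M : Matrix (Fin d) (Fin d) ℝ) (x ξ : Space d) :
    character (act M x) ξ = character x (act M.transpose ξ) := by
  simp only [character]
  rw [real_inner_comm, inner_act, real_inner_comm]

/-- Substitute `η = Hᵗ ξ`. It exhibits `s ↦ 𝓕 φ (H s + x)` as a multiple of the transform of another
test function, so that the duality defining `𝓕 ψ` can be applied to `ψ` itself. -/
theorem fourier_modulate_dilate (H : GL (Fin d) ℝ) (x s : Space d) (φ : Space d → ℂ) :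
    𝓕 (fun η => φ (act ((transposeGL H)⁻¹ : GL (Fin d) ℝ) η) *
        character x (act ((transposeGL H)⁻¹ : GL (Fin d) ℝ) η)) s =
      |(H : Matrix (Fin d) (Fin d) ℝ).det| * 𝓕 φ (act H s + x) := by
  have h := integral_comp_act (transposeGL H) (fun η => character s η *
    (φ (act ((transposeGL H)⁻¹ : GL (Fin d) ℝ) η) *
        character x (act ((transposeGL H)⁻¹ : GL (Fin d) ℝ) η)))
  simp only [act_inv_act] at h
  rw [← fourier_eq_integral_character, transposeGL_val, Matrix.det_transpose] at h
  rw [← inv_smul_eq_iff₀ (inv_ne_zero (abs_det_pos H).ne'), inv_inv] at h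
  rw [← h, fourier_eq_integral_character, Complex.real_smul]
  congr 1
  refine integral_congr_ae (.of_forall fun ξ => ?_)
  simp only [character_add, character_act]
  ring

/-- Substitute `t = h s + x`; the Jacobian `|det h|` times the normalization `|det h|^{-1/2}` leaves
`|det h|^{1/2}`. -/
theorem integral_quasiReg (g : AffGroup A) (ψ : L2Space d) (v : Space d → ℂ) :
    ∫ t, v t * quasiReg g ψ t = ((|g.mat.det| ^ (1 / 2 : ℝ) : ℝ) : ℂ) *
      ∫ s, v (act g.mat s + g.trans) * ψ s := by
  set H : GL (Fin d) ℝ := g.dil.val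
  have hmat : g.mat = H := rfl
  have hinv : g.matInv = ((H⁻¹ : GL (Fin d) ℝ) : Matrix _ _ ℝ) := rfl
  have h1 : ∫ t, v t * quasiReg g ψ t = ∫ t, v t *
      (((|g.mat.det| ^ (-(1 / 2) : ℝ) : ℝ) : ℂ) * ψ (act g.matInv (t - g.trans))) :=
    integral_congr_ae ((quasiReg_ae g ψ).mono fun t ht => by simp only [ht])
  rw [h1, ← integral_add_right_eq_self _ g.trans]
  have h2 := integral_comp_act H (fun t => v (t + g.trans) *
      (((|g.mat.det| ^ (-(1 / 2) : ℝ) : ℝ) : ℂ) * ψ (act g.matInv (t + g.trans - g.trans))))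
  rw [← inv_smul_eq_iff₀ (inv_ne_zero (abs_det_pos H).ne'), inv_inv] at h2
  rw [← h2]
  simp only [add_sub_cancel_right, hinv, hmat, act_inv_act]
  rw [Complex.real_smul, ← integral_const_mul, ← integral_const_mul]
  refine integral_congr_ae (.of_forall fun s => ?_)
  have hc : ((|(H : Matrix (Fin d) (Fin d) ℝ).det| : ℝ) : ℂ) *
      ((|(H : Matrix (Fin d) (Fin d) ℝ).det| ^ (-(1 / 2) : ℝ) : ℝ) : ℂ) =
      ((|(H : Matrix (Fin d) (Fin d) ℝ).det| ^ (1 / 2 : ℝ) : ℝ) : ℂ) := by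
    rw [← Complex.ofReal_mul]
    congr 1
    rw [← Real.rpow_one_add' (abs_nonneg _) (by norm_num)]
    norm_num
  simp only [← hc]
  ring

theorem memLp_fourier_dilate (H : GL (Fin d) ℝ) (c : ℂ) (ψ : L2Space d) :
    MemLp (fun ξ => c * (𝓕 ψ : L2Space d) (act (H : Matrix _ _ ℝ).transpose ξ)) 2
      (volume : Measure (Space d)) := by
  simpa using memLp_dilate (transposeGL H) 0 c (𝓕 ψ : L2Space d)

/-- The quasi-regular representation on the Fourier side. -/
theorem fourier_quasiReg (g : AffGroup A) (ψ : L2Space d) :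
    (𝓕 (quasiReg g ψ) : L2Space d) =ᵐ[volume] fun ξ => character g.trans ξ *
      (((|g.mat.det| ^ (1 / 2 : ℝ) : ℝ) : ℂ) * (𝓕 ψ : L2Space d) (act g.mat.transpose ξ)) := by
  set c : ℂ := ((|g.mat.det| ^ (1 / 2 : ℝ) : ℝ) : ℂ)
  set H : GL (Fin d) ℝ := g.dil.val
  have hmat : g.mat = H := rfl
  have hmem : MemLp (fun ξ => character g.trans ξ *
      (c * (𝓕 ψ : L2Space d) (act g.mat.transpose ξ))) 2 volume := by
    have h := memLp_fourier_dilate H c ψ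
    refine h.congr_norm ((contDiff_character _).continuous.aestronglyMeasurable.mul h.1) ?_
    exact .of_forall fun ξ => by
      rw [norm_mul (character _ _), norm_character, one_mul, hmat]
  refine fourier_L2_ae_eq (hmem.locallyIntegrable one_le_two) fun φ hφ => ?_
  rw [integral_quasiReg]
  -- The translation and dilation are moved onto the test function: `φ ∘ K` times a character is
  -- still smooth and compactly supported.
  set K : GL (Fin d) ℝ := (transposeGL H)⁻¹
  have hK : ContDiff ℝ (⊤ : ℕ∞) (actEquiv K) := (actEquiv K).contDiff
  have hsupp : HasCompactSupport fun η => φ (act K η) * character g.trans (act K η) :=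
    (hφ.comp_homeomorph (actEquiv K).toHomeomorph).mul_right
  have hsmooth : ContDiff ℝ (⊤ : ℕ∞) fun η => φ (act K η) * character g.trans (act K η) :=
    (φ.smooth'.comp hK).mul ((contDiff_character _).comp hK)
  have h1 := integral_smul_fourier_L2 ψ (hsupp.toSchwartzMap hsmooth)
  have hcoe : ⇑(hsupp.toSchwartzMap hsmooth) =
      fun η => φ (act K η) * character g.trans (act K η) := rfl
  rw [hcoe] at h1
  simp only [K, fourier_modulate_dilate] at h1
  have h2 := integral_comp_act (transposeGL H) (fun η => φ (act K η) *
    character g.trans (act K η) * (𝓕 ψ : L2Space d) η)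
  simp only [K, act_inv_act] at h2
  simp only [transposeGL_val, Matrix.det_transpose] at h2
  rw [h1] at h2
  simp only [mul_assoc] at h2
  rw [integral_const_mul, Complex.real_smul, ← mul_assoc, ← Complex.ofReal_mul,
    inv_mul_cancel₀ (abs_det_pos H).ne', Complex.ofReal_one, one_mul] at h2
  simp only [hmat]
  rw [← h2, ← integral_const_mul]
  refine integral_congr_ae (.of_forall fun ξ => ?_)
  simp only [c, hmat]
  ring

/-- The `L²` norm over translations of the wavelet transform of a function whose Fourier transform
is an indicator. -/
theorem lintegral_inner_quasiReg_sq (h : Subgroup.zpowers A) (ψ : L2Space d) {E : Set (Space d)}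
    (hE : MeasurableSet E) (hEt : volume E ≠ ∞) :
    ∫⁻ x, ‖(inner ℂ (quasiReg (⟨x, h⟩ : AffGroup A) ψ)
        (𝓕⁻ (indicatorConstLp 2 hE hEt (1 : ℂ)) : L2Space d) : ℂ)‖ₑ ^ 2 =
      ENNReal.ofReal |((h : GL (Fin d) ℝ) : Matrix (Fin d) (Fin d) ℝ).det| *
        ∫⁻ ξ in E, ‖(𝓕 ψ : L2Space d)
          (act ((h : GL (Fin d) ℝ) : Matrix (Fin d) (Fin d) ℝ).transpose ξ)‖ₑ ^ 2 := by
  set H : GL (Fin d) ℝ := h.val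
  set c : ℂ := ((|(H : Matrix (Fin d) (Fin d) ℝ).det| ^ (1 / 2 : ℝ) : ℝ) : ℂ)
  set v : Space d → ℂ := fun ξ => c * (𝓕 ψ : L2Space d) (act (H : Matrix _ _ ℝ).transpose ξ)
  have hv : MemLp v 2 volume := memLp_fourier_dilate H c ψ
  have hu2 : MemLp (E.indicator v) 2 volume := hv.indicator hE
  have hu : Integrable (E.indicator v) := by
    rw [integrable_indicator_iff hE]
    have : IsFiniteMeasure (volume.restrict E) := ⟨by simpa using hEt.lt_top⟩
    exact (hv.restrict E).integrable one_le_two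
  -- By Plancherel the conjugate of the inner product is the integral over `E` of `character x`
  -- times `v`, hence the Fourier transform at `x` of `v` cut off to `E`. Finite measure of `E`
  -- makes this cutoff integrable.
  have hin (x : Space d) : ‖(inner ℂ (quasiReg (⟨x, h⟩ : AffGroup A) ψ)
        (𝓕⁻ (indicatorConstLp 2 hE hEt (1 : ℂ)) : L2Space d) : ℂ)‖ₑ =
      ‖𝓕 (E.indicator v) x‖ₑ := by
    rw [← Lp.inner_fourier_eq, fourier_fourierInv_eq, ← inner_conj_symm, RCLike.enorm_conj,
      L2.inner_indicatorConstLp_one, fourier_eq_integral_character, ← integral_indicator hE]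
    congr 1
    refine integral_congr_ae ?_
    filter_upwards [fourier_quasiReg (⟨x, h⟩ : AffGroup A) ψ] with ξ hξ
    by_cases hm : ξ ∈ E
    · simp only [Set.indicator_of_mem hm, hξ]
      rfl
    · simp [Set.indicator_of_notMem hm]
  simp_rw [hin]
  rw [lintegral_enorm_fourier_sq hu hu2, ← lintegral_const_mul' _ _ ENNReal.ofReal_ne_top,
    ← lintegral_indicator hE]
  refine lintegral_congr fun ξ => ?_
  by_cases hm : ξ ∈ E
  · simp only [Set.indicator_of_mem hm, v, enorm_mul, mul_pow]
    congr 1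
    rw [← ofReal_norm, ← ENNReal.ofReal_pow (norm_nonneg _)]
    congr 1
    simp only [c, Complex.norm_real, Real.norm_eq_abs, sq_abs]
    rw [← Real.rpow_natCast, ← Real.rpow_mul (abs_nonneg _)]
    norm_num
  · simp [Set.indicator_of_notMem hm]

theorem measurable_fourier_dilate (M : Matrix (Fin d) (Fin d) ℝ) (ψ : L2Space d) :
    Measurable fun ξ => ‖(𝓕 ψ : L2Space d) (act M ξ)‖ₑ ^ 2 :=
  ((Lp.stronglyMeasurable _).measurable.comp (continuous_act M).measurable).enorm.pow_const 2

theorem measurable_calderonSum (ψ : L2Space d) : Measurable (calderonSum A ψ) :=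
  Measurable.tsum fun _ => measurable_fourier_dilate _ ψ

theorem calderonSum_eq_tsum_zpowers (hA : Function.Injective fun j : ℤ => A ^ j) (ψ : L2Space d)
    (ξ : Space d) :
    calderonSum A ψ ξ = ∑' h : Subgroup.zpowers A, ‖(𝓕 ψ : L2Space d)
      (act ((h : GL (Fin d) ℝ) : Matrix (Fin d) (Fin d) ℝ).transpose ξ)‖ₑ ^ 2 := by
  rw [← (Equiv.ofBijective (fun j : ℤ =>
    (⟨A ^ j, j, rfl⟩ : Subgroup.zpowers A)) ⟨fun j j' h => hA (congrArg Subtype.val h),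
      fun ⟨_, j, hj⟩ => ⟨j, Subtype.ext hj⟩⟩).tsum_eq]
  refine tsum_congr fun j => ?_
  rw [← Matrix.transpose_zpow, ← Matrix.coe_units_zpow]
  rfl

/-- The continuous frame sum of a function whose Fourier transform is an indicator. -/
theorem lintegral_haar_inner_quasiReg_sq (hA : Function.Injective fun j : ℤ => A ^ j)
    (ψ : L2Space d) {E : Set (Space d)} (hE : MeasurableSet E) (hEt : volume E ≠ ∞) :
    ∫⁻ g, ‖(inner ℂ (quasiReg g ψ)
        (𝓕⁻ (indicatorConstLp 2 hE hEt (1 : ℂ)) : L2Space d) : ℂ)‖ₑ ^ 2 ∂AffGroup.haar A =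
      ∫⁻ ξ in E, calderonSum A ψ ξ := by
  simp_rw [calderonSum_eq_tsum_zpowers hA]
  rw [AffGroup.lintegral_haar, lintegral_tsum fun h =>
    (measurable_fourier_dilate _ ψ).aemeasurable]
  refine tsum_congr fun h => ?_
  -- The Haar weight cancels the determinant produced by Plancherel on each fibre.
  rw [lintegral_inner_quasiReg_sq, ENNReal.ofReal_inv_of_pos (abs_det_pos _),
    ENNReal.inv_mul_cancel_left (by simpa using abs_det_pos h.val) ENNReal.ofReal_ne_top]

/-- Testing the frame on inverse transforms of indicators compares integrals over every set of
finite measure, which forces the comparison almost everywhere. -/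
theorem calderonSum_mem_Icc_of_isContinuousFrame (hA : Function.Injective fun j : ℤ => A ^ j)
    {ψ : L2Space d} {c C : ℝ}
    (hF : IsContinuousFrame (AffGroup.haar A) (semiContinuousSystem A ψ) c C) :
    ∀ᵐ ξ : Space d, ENNReal.ofReal c ≤ calderonSum A ψ ξ ∧
      calderonSum A ψ ξ ≤ ENNReal.ofReal C := by
  have key (E : Set (Space d)) (hE : MeasurableSet E) (hEt : volume E < ∞) :
      ∫⁻ _ in E, ENNReal.ofReal c ≤ ∫⁻ ξ in E, calderonSum A ψ ξ ∧
        ∫⁻ ξ in E, calderonSum A ψ ξ ≤ ∫⁻ _ in E, ENNReal.ofReal C := by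
    obtain ⟨hc, hcC, hF⟩ := hF
    have h := (hF (𝓕⁻ (indicatorConstLp 2 hE hEt.ne (1 : ℂ)) : L2Space d)).2
    have hnorm : ‖(𝓕⁻ (indicatorConstLp 2 hE hEt.ne (1 : ℂ)) : L2Space d)‖ ^ 2 =
        (volume E).toReal := by
      rw [← Lp.norm_fourier_eq, fourier_fourierInv_eq, norm_indicatorConstLp two_ne_zero
        ENNReal.ofNat_ne_top, norm_one, one_mul, ← Real.rpow_natCast, ← Real.rpow_mul
        measureReal_nonneg]
      norm_num [Measure.real]
    have hlin : ∫⁻ g, ‖(inner ℂ (semiContinuousSystem A ψ g)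
        (𝓕⁻ (indicatorConstLp 2 hE hEt.ne (1 : ℂ)) : L2Space d) : ℂ)‖ₑ ^ 2 ∂AffGroup.haar A =
        ∫⁻ ξ in E, calderonSum A ψ ξ := lintegral_haar_inner_quasiReg_sq hA ψ hE hEt.ne
    rw [hnorm, hlin, ENNReal.ofReal_mul hc.le, ENNReal.ofReal_mul (hc.le.trans hcC),
      ENNReal.ofReal_toReal hEt.ne] at h
    simpa only [setLIntegral_const] using h
  filter_upwards [ae_le_of_forall_setLIntegral_le_of_sigmaFinite measurable_const
      fun E hE hEt => (key E hE hEt).1,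
    ae_le_of_forall_setLIntegral_le_of_sigmaFinite (measurable_calderonSum ψ)
      fun E hE hEt => (key E hE hEt).2] with ξ h1 h2
  exact ⟨h1, h2⟩

end Fourier

end

end WaveletFrames

theorem mainTheorem1 {d : ℕ} (A P : GL (Fin d) ℝ) (ψ : WaveletFrames.L2Space d)
    (hψ : ψ ∈ WaveletFrames.besselSpace A) :
    (∀ C₁ C₂ : ℝ,
      WaveletFrames.IsFrame (WaveletFrames.discreteSystem A P ψ) C₁ C₂ →
        WaveletFrames.IsContinuousFrame (WaveletFrames.AffGroup.haar A)
            (WaveletFrames.semiContinuousSystem A ψ)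
            (C₁ * |(P : Matrix (Fin d) (Fin d) ℝ).det|)
            (C₂ * |(P : Matrix (Fin d) (Fin d) ℝ).det|) ∧
          ∀ᵐ ξ : WaveletFrames.Space d,
            ENNReal.ofReal (C₁ * |(P : Matrix (Fin d) (Fin d) ℝ).det|) ≤
                WaveletFrames.calderonSum A ψ ξ ∧
              WaveletFrames.calderonSum A ψ ξ ≤
                ENNReal.ofReal (C₂ * |(P : Matrix (Fin d) (Fin d) ℝ).det|)) ∧
    (WaveletFrames.IsFrame (WaveletFrames.discreteSystem A P ψ) 1 1 →
        WaveletFrames.IsContinuousFrame (WaveletFrames.AffGroup.haar A)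
            (WaveletFrames.semiContinuousSystem A ψ)
            |(P : Matrix (Fin d) (Fin d) ℝ).det| |(P : Matrix (Fin d) (Fin d) ℝ).det| ∧
          ∀ᵐ ξ : WaveletFrames.Space d,
            WaveletFrames.calderonSum A ψ ξ =
              ENNReal.ofReal |(P : Matrix (Fin d) (Fin d) ℝ).det|) := by
  have main (C₁ C₂ : ℝ) (hF : WaveletFrames.IsFrame (WaveletFrames.discreteSystem A P ψ) C₁ C₂) :=
    And.intro (WaveletFrames.isContinuousFrame_of_isFrame hψ hF)
      (WaveletFrames.calderonSum_mem_Icc_of_isContinuousFrame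
        (WaveletFrames.zpow_injective_of_isFrame hF)
        (WaveletFrames.isContinuousFrame_of_isFrame hψ hF))
  refine ⟨main, fun hF => ?_⟩
  have h := main 1 1 hF
  rw [one_mul] at h
  exact ⟨h.1, h.2.mono fun ξ hξ => le_antisymm hξ.2 hξ.1⟩
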